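/- **Conventions.** Manifolds are smooth, finite-dimensional, Hausdorff and second countable. $\mathbb R^\times$ denotes either $\mathbb R\setminus\{0\}$ or $\mathbb R^+$. For a bivector field $\Pi$ put $\{F,G\}=\Pi(dF,dG)$; $\Pi$ is a Poisson structure if this bracket on $C^\infty(P)$ satisfies the Jacobi identity. The Hamiltonian vector field of $H$ is $X_H=-i(dH)\Pi=\Pi(\cdot,dH)$, i.e. $X_H(F)=\{F,H\}$. A *Kirillov bracket* on the sections of a line bundle $L^*\to K$ is a real Lie bracket $[\cdot,\cdot]$ on $\Gamma(L^*)$ such that for every $h\in\Gamma(L^*)$ there is a vector field $X_h$ on $K$, the *symbol* of $[\cdot,h]$, with $[fh_1,h]=f[h_1,h]+X_h(f)\,h_1$ for all $f\in C^\infty(K)$, $h_1\in\Gamma(L^*)$. **Theorem.** Let $p:P\to K=P/\mathbb R^\times$ be a principal $\mathbb R^\times$-bundle with action $\phi$, and let $\Pi$ be a Poisson structure on $P$ with $\wedge^2T\phi_s\circ\Pi=s\,\Pi\circ\phi_s$ for all $s\in\mathbb R^\times$. Let $L=(P\times\mathbb R)/\mathbb R^\times\to K$ be the line bundle associated with the action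 $s\cdot(x,t)=(\phi_s(x),t/s)$, and $L^*$ its dual. (a) The map $h\mapsto H_h$, $H_h(x)=h(p(x))([x,1])$, is a bijection from the smooth sections of $L^*$ onto the smooth functions $H:P\to\mathbb R$ with $H\circ\phi_s=sH$ for all $s\in\mathbb R^\times$; moreover $h(p(x))([x,t])=t\,H_h(x)$ for all $x\in P$, $t\in\mathbb R$. (b) There is a unique Kirillov bracket $[\cdot,\cdot]$ on $\Gamma(L^*)$ such that $\{H_{h_1},H_{h_2}\}=-H_{[h_1,h_2]}$ for all $h_1,h_2\in\Gamma(L^*)$. The symbol $X_h$ of $[\cdot,h]$ is uniquely determined by $h$. (c) For every $h\in\Gamma(L^*)$ the Hamiltonian vector field $X_{H_h}$ is $p$-projectable, and its projection is the symbol of the derivation $[h,\cdot]$, that is, the vector field $-X_h$: $Tp\circ X_{H_h}=-X_h\circ p$. (d) $[X_{h_1},X_{h_2}]=-X_{[h_1,h_2]}$ for all $h_1,h_2\in\Gamma(L^*)$. -/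

import Mathlib

open Bundle Set Topology
open scoped Manifold ContDiff Bundle Topology

noncomputable section

namespace ScalingReduction

/-! ## The scaling group

`ℝ^×` stands for either of the Lie groups `ℝ ∖ {0}` and `ℝ⁺`. These are exactly the open subgroups
of `ℝˣ`, see `openSubgroup_units_real`. -/

/-- An open subgroup of `ℝˣ` is an open submanifold of `ℝˣ`. -/
instance instChartedSpaceScale (G : OpenSubgroup ℝˣ) : ChartedSpace ℝ G :=
  inferInstanceAs (ChartedSpace ℝ (G : TopologicalSpace.Opens ℝˣ))

instance instIsManifoldScale (G : OpenSubgroup ℝˣ) : IsManifold 𝓘(ℝ, ℝ) ∞ G :=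
  inferInstanceAs (IsManifold 𝓘(ℝ, ℝ) ∞ (G : TopologicalSpace.Opens ℝˣ))

/-- The real number underlying an element of the scaling group. -/
def scale {G : OpenSubgroup ℝˣ} (s : G) : ℝ := ((s : ℝˣ) : ℝ)

theorem openSubgroup_units_real (G : OpenSubgroup ℝˣ) :
    (G : Set ℝˣ) = univ ∨ (G : Set ℝˣ) = {s : ℝˣ | 0 < (s : ℝ)} := by
  have hpos : ∀ s : ℝˣ, 0 < (s : ℝ) → s ∈ G := by
    intro s hs
    let f : ℝ → ℝˣ := fun r => Units.mk0 (Real.exp r) (Real.exp_pos r).ne'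
    have hf : Continuous f := by
      rw [Units.isOpenEmbedding_val.isEmbedding.continuous_iff]
      exact Real.continuous_exp
    have hmem : {r | f r ∈ G} ∈ 𝓝 (0 : ℝ) := by
      apply hf.continuousAt.preimage_mem_nhds
      have : f 0 = 1 := by ext; simp [f]
      rw [this]
      exact G.isOpen.mem_nhds G.one_mem
    have htend : Filter.Tendsto (fun n : ℕ => Real.log s / (n + 1 : ℝ)) Filter.atTop (𝓝 0) := by
      have := tendsto_one_div_add_atTop_nhds_zero_nat (𝕜 := ℝ) |>.const_mul (Real.log s)
      simpa [div_eq_mul_inv] using this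
    obtain ⟨n, hn⟩ := (htend.eventually hmem).exists
    have hpow : f (Real.log s / (n + 1 : ℝ)) ^ (n + 1) = s := by
      ext
      simp only [f, Units.val_pow_eq_pow_val, Units.val_mk0]
      rw [← Real.exp_nat_mul]
      push_cast
      rw [mul_div_cancel₀ _ (by positivity), Real.exp_log hs]
    rw [← hpow]
    exact G.toSubgroup.pow_mem hn _
  by_cases h : ∃ s ∈ G, (s : ℝ) < 0
  · left
    obtain ⟨s, hs, hneg⟩ := h
    ext t
    simp only [SetLike.mem_coe, mem_univ, iff_true]
    rcases lt_or_gt_of_ne t.ne_zero with ht | ht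
    · have : t = s * (s⁻¹ * t) := by group
      rw [this]
      refine G.mul_mem hs (hpos _ ?_)
      rw [Units.val_mul, Units.val_inv_eq_inv_val]
      exact mul_pos_of_neg_of_neg (inv_lt_zero.2 hneg) ht
    · exact hpos t ht
  · right
    push Not at h
    ext t
    exact ⟨fun ht => lt_of_le_of_ne (h t ht) t.ne_zero.symm, hpos t⟩

theorem scale_ne_zero {G : OpenSubgroup ℝˣ} (s : G) : scale s ≠ 0 := Units.ne_zero _

@[simp]
theorem scale_one {G : OpenSubgroup ℝˣ} : scale (1 : G) = 1 := rfl

@[simp]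
theorem scale_mul {G : OpenSubgroup ℝˣ} (s t : G) : scale (s * t) = scale s * scale t := rfl

@[simp]
theorem scale_inv {G : OpenSubgroup ℝˣ} (s : G) : scale s⁻¹ = (scale s)⁻¹ :=
  Units.val_inv_eq_inv_val _

theorem contMDiff_scale {G : OpenSubgroup ℝˣ} :
    ContMDiff 𝓘(ℝ, ℝ) 𝓘(ℝ, ℝ) ∞ (scale : G → ℝ) :=
  Units.contMDiff_val.comp
    (contMDiff_subtype_val (I := 𝓘(ℝ, ℝ)) (U := (G : TopologicalSpace.Opens ℝˣ)))

/-! ## Principal bundles -/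

/-- A principal bundle `proj : P → K` with structure group `G` (`ℝ ∖ {0}` or `ℝ⁺`): a smooth action
of `G` on `P`, and around every point of `K` a smooth equivariant local trivialization
`proj ⁻¹' U ≃ U × G`. Consequently the action is free, `proj` is a surjective submersion
and its fibres are the orbits, so that `K` is the orbit manifold `P / G`. -/
structure ScalingBundle (G : OpenSubgroup ℝˣ)
    (EP : Type*) [NormedAddCommGroup EP] [NormedSpace ℝ EP]
    (P : Type*) [TopologicalSpace P] [ChartedSpace EP P] [MulAction G P]
    (EK : Type*) [NormedAddCommGroup EK] [NormedSpace ℝ EK]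
    (K : Type*) [TopologicalSpace K] [ChartedSpace EK K] where
  proj : P → K
  contMDiff_smul : ContMDiff (𝓘(ℝ, ℝ).prod 𝓘(ℝ, EP)) 𝓘(ℝ, EP) ∞ (fun q : G × P => q.1 • q.2)
  proj_smul : ∀ (s : G) (x : P), proj (s • x) = proj x
  exists_trivialization : ∀ k : K, ∃ e : Trivialization G proj, k ∈ e.baseSet ∧
    ContMDiffOn 𝓘(ℝ, EP) (𝓘(ℝ, EK).prod 𝓘(ℝ, ℝ)) ∞ e e.source ∧
    ContMDiffOn (𝓘(ℝ, EK).prod 𝓘(ℝ, ℝ)) 𝓘(ℝ, EP) ∞ e.toOpenPartialHomeomorph.symm e.target ∧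
    ∀ (s : G), ∀ x ∈ e.source, (e (s • x)).2 = s * (e x).2

namespace ScalingBundle

variable {G : OpenSubgroup ℝˣ}
  {EP : Type*} [NormedAddCommGroup EP] [NormedSpace ℝ EP]
  {P : Type*} [TopologicalSpace P] [ChartedSpace EP P] [MulAction G P]
  {EK : Type*} [NormedAddCommGroup EK] [NormedSpace ℝ EK]
  {K : Type*} [TopologicalSpace K] [ChartedSpace EK K]
  (B : ScalingBundle G EP P EK K)

/-- The smooth equivariant local trivializations of a principal bundle. -/
structure Triv where
  e : Trivialization G B.proj
  smooth : ContMDiffOn 𝓘(ℝ, EP) (𝓘(ℝ, EK).prod 𝓘(ℝ, ℝ)) ∞ e e.source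
  smooth_symm :
    ContMDiffOn (𝓘(ℝ, EK).prod 𝓘(ℝ, ℝ)) 𝓘(ℝ, EP) ∞ e.toOpenPartialHomeomorph.symm e.target
  equivariant : ∀ (s : G), ∀ x ∈ e.source, (e (s • x)).2 = s * (e x).2

theorem exists_triv (k : K) : ∃ T : B.Triv, k ∈ T.e.baseSet := by
  obtain ⟨e, hk, h1, h2, h3⟩ := B.exists_trivialization k
  exact ⟨⟨e, h1, h2, h3⟩, hk⟩

variable {B}

theorem Triv.smul_mem (T : B.Triv) {x : P} (hx : x ∈ T.e.source) (s : G) :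
    s • x ∈ T.e.source := by
  rw [T.e.mem_source] at hx ⊢
  rwa [B.proj_smul]

variable (B)

theorem eq_one_of_smul_eq (B : ScalingBundle G EP P EK K) {s : G} {x : P} (h : s • x = x) : s = 1 := by
  obtain ⟨T, hT⟩ := B.exists_triv (B.proj x)
  have := T.equivariant s x (T.e.mem_source.2 hT)
  rw [h] at this
  exact (mul_eq_right.1 this.symm)

theorem exists_smul_eq {x y : P} (h : B.proj x = B.proj y) : ∃ s : G, y = s • x := by
  obtain ⟨T, hT⟩ := B.exists_triv (B.proj x)
  have hx : x ∈ T.e.source := T.e.mem_source.2 hT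
  have hy : y ∈ T.e.source := T.e.mem_source.2 (h ▸ hT)
  refine ⟨(T.e y).2 * (T.e x).2⁻¹, T.e.injOn hy (T.smul_mem hx _) ?_⟩
  refine Prod.ext ?_ ?_
  · change (T.e y).1 = (T.e (_ • x)).1
    rw [T.e.coe_fst hy, T.e.coe_fst (T.smul_mem hx _), B.proj_smul, h]
  · change (T.e y).2 = (T.e (_ • x)).2
    rw [T.equivariant _ _ hx]
    group

theorem proj_surjective : Function.Surjective B.proj := by
  intro k
  obtain ⟨T, hT⟩ := B.exists_triv k
  exact ⟨T.e.toOpenPartialHomeomorph.symm (k, 1), T.e.proj_symm_apply' hT⟩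

/-! ## The associated line bundle

`L = (P × ℝ) / G` for the action `s · (x, t) = (s · x, t / s)`, with fibres
`L_k = (proj ⁻¹' {k} × ℝ) / G`. -/

/-- The orbit relation of the action `s · (x, t) = (s · x, t / s)` over the point `k`. -/
def lineSetoid (k : K) : Setoid ({x : P // B.proj x = k} × ℝ) where
  r a b := ∃ s : G, (b.1 : P) = s • (a.1 : P) ∧ b.2 = a.2 / scale s
  iseqv :=
    { refl := fun a => ⟨1, by simp, by simp⟩
      symm := by
        rintro a b ⟨s, h1, h2⟩
        refine ⟨s⁻¹, by rw [h1, inv_smul_smul], ?_⟩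
        rw [h2, scale_inv]
        field_simp [scale_ne_zero s]
      trans := by
        rintro a b c ⟨s, h1, h2⟩ ⟨t, h3, h4⟩
        refine ⟨t * s, by rw [h3, h1, mul_smul], ?_⟩
        rw [h4, h2, scale_mul, div_div, mul_comm] }

/-- The fibre `L_k` of the associated line bundle. -/
def LineFiber (k : K) : Type _ := Quotient (B.lineSetoid k)

/-- The class of `(x, t)` in the fibre over `k = proj x`. -/
def fiberMk {k : K} (x : {x : P // B.proj x = k}) (t : ℝ) : B.LineFiber k :=
  Quotient.mk (B.lineSetoid k) (x, t)

/-- The quotient map `P × ℝ → L`. -/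
def lineMk (x : P) (t : ℝ) : B.LineFiber (B.proj x) := B.fiberMk ⟨x, rfl⟩ t

theorem fiberMk_bijective {k : K} (x : {x : P // B.proj x = k}) :
    Function.Bijective (B.fiberMk x) := by
  constructor
  · intro t u h
    obtain ⟨s, h1, h2⟩ := Quotient.exact h
    have : s = 1 := B.eq_one_of_smul_eq h1.symm
    subst this
    simpa using h2.symm
  · intro z
    induction z using Quotient.inductionOn with
    | h a =>
      obtain ⟨y, u⟩ := a
      obtain ⟨s, hs⟩ := B.exists_smul_eq (y.2.trans x.2.symm)
      exact ⟨u / scale s, (Quotient.sound ⟨s, hs, rfl⟩ :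
        Quotient.mk (B.lineSetoid k) (y, u) = Quotient.mk (B.lineSetoid k) _).symm⟩

/-- A point of the fibre of `P` over `k`. -/
def pt (k : K) : {x : P // B.proj x = k} :=
  ⟨(B.proj_surjective k).choose, (B.proj_surjective k).choose_spec⟩

/-- The identification of `L_k` with `ℝ` given by a point of the fibre of `P` over `k`. -/
def fiberEquiv (k : K) : B.LineFiber k ≃ ℝ :=
  (Equiv.ofBijective _ (B.fiberMk_bijective (B.pt k))).symm

/-- The vector space structure of `L_k`; it does not depend on the point of the fibre used to
define it, see `fiberMk_add` and `smul_fiberMk`. -/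
instance instAddCommGroupLineFiber (k : K) : AddCommGroup (B.LineFiber k) :=
  (B.fiberEquiv k).addCommGroup

instance instModuleLineFiber (k : K) : Module ℝ (B.LineFiber k) :=
  (B.fiberEquiv k).module ℝ

instance instTopologicalSpaceLineFiber (k : K) : TopologicalSpace (B.LineFiber k) :=
  TopologicalSpace.induced (B.fiberEquiv k) inferInstance

/-- `fiberEquiv` as a linear equivalence. -/
def fiberLinearEquiv (k : K) : B.LineFiber k ≃ₗ[ℝ] ℝ := (B.fiberEquiv k).linearEquiv ℝ

theorem fiberEquiv_symm_apply (k : K) (t : ℝ) :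
    (B.fiberLinearEquiv k).symm t = B.fiberMk (B.pt k) t := rfl

theorem fiberMk_smul {k : K} {x y : {x : P // B.proj x = k}} {s : G}
    (h : (y : P) = s • (x : P)) (t : ℝ) : B.fiberMk y t = B.fiberMk x (scale s * t) := by
  refine (Quotient.sound ⟨s, h, ?_⟩ :
    Quotient.mk (B.lineSetoid k) (x, scale s * t) = Quotient.mk (B.lineSetoid k) (y, t)).symm
  field_simp [scale_ne_zero s]

theorem fiberLinearEquiv_fiberMk {k : K} {x : {x : P // B.proj x = k}} {s : G}
    (h : (x : P) = s • (B.pt k : P)) (t : ℝ) :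
    B.fiberLinearEquiv k (B.fiberMk x t) = scale s * t := by
  rw [B.fiberMk_smul h, ← fiberEquiv_symm_apply, LinearEquiv.apply_symm_apply]

theorem fiberMk_add {k : K} (x : {x : P // B.proj x = k}) (t u : ℝ) :
    B.fiberMk x (t + u) = B.fiberMk x t + B.fiberMk x u := by
  obtain ⟨s, hs⟩ := B.exists_smul_eq ((B.pt k).2.trans x.2.symm)
  apply (B.fiberLinearEquiv k).injective
  rw [map_add]
  simp only [B.fiberLinearEquiv_fiberMk hs]
  ring

theorem smul_fiberMk {k : K} (x : {x : P // B.proj x = k}) (c t : ℝ) :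
    c • B.fiberMk x t = B.fiberMk x (c * t) := by
  obtain ⟨s, hs⟩ := B.exists_smul_eq ((B.pt k).2.trans x.2.symm)
  apply (B.fiberLinearEquiv k).injective
  rw [map_smul]
  simp only [B.fiberLinearEquiv_fiberMk hs, smul_eq_mul]
  ring

variable {B}

/-- The homogeneous function `τ : proj ⁻¹' U → ℝ^×` given by a local trivialization. -/
def Triv.tau (T : B.Triv) (x : P) : ℝ := scale (T.e x).2

theorem Triv.tau_ne_zero (T : B.Triv) (x : P) : T.tau x ≠ 0 := scale_ne_zero _

theorem Triv.tau_smul (T : B.Triv) {x : P} (hx : B.proj x ∈ T.e.baseSet) (s : G) :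
    T.tau (s • x) = scale s * T.tau x := by
  rw [Triv.tau, T.equivariant s x (T.e.mem_source.2 hx), scale_mul, Triv.tau]

/-- The local trivialization `[x, t] ↦ (proj x, t * τ x)` of the associated line bundle given by a
local trivialization `x ↦ (proj x, τ x)` of the principal bundle, see `lineTriv_mk`. -/
def Triv.lineTriv (T : B.Triv) : Pretrivialization ℝ (π ℝ B.LineFiber) where
  toFun z := (z.1, T.tau (B.pt z.1) * B.fiberLinearEquiv z.1 z.2)
  invFun z := ⟨z.1, (B.fiberLinearEquiv z.1).symm (z.2 / T.tau (B.pt z.1))⟩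
  source := π ℝ B.LineFiber ⁻¹' T.e.baseSet
  target := T.e.baseSet ×ˢ univ
  map_source' z hz := ⟨hz, mem_univ _⟩
  map_target' z hz := hz.1
  left_inv' := by
    rintro ⟨k, l⟩ -
    simp [mul_div_cancel_left₀ _ (T.tau_ne_zero (B.pt k))]
  right_inv' := by
    rintro ⟨k, u⟩ -
    simp [mul_div_cancel₀ _ (T.tau_ne_zero (B.pt k))]
  open_target := T.e.open_baseSet.prod isOpen_univ
  baseSet := T.e.baseSet
  open_baseSet := T.e.open_baseSet
  source_eq := rfl
  target_eq := rfl
  proj_toFun _ _ := rfl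

theorem Triv.lineTriv_mk (T : B.Triv) {x : P} (hx : B.proj x ∈ T.e.baseSet) (t : ℝ) :
    T.lineTriv ⟨B.proj x, B.lineMk x t⟩ = (B.proj x, t * T.tau x) := by
  obtain ⟨s, hs⟩ := B.exists_smul_eq (B.pt (B.proj x)).2
  have h1 : B.fiberLinearEquiv (B.proj x) (B.lineMk x t) = scale s * t :=
    B.fiberLinearEquiv_fiberMk (x := ⟨x, rfl⟩) hs t
  have h2 : T.tau x = scale s * T.tau (B.pt (B.proj x)) := by
    conv_lhs => rw [hs]
    exact T.tau_smul (by rwa [(B.pt (B.proj x)).2]) s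
  change (B.proj x, T.tau (B.pt (B.proj x)) * B.fiberLinearEquiv (B.proj x) (B.lineMk x t)) = _
  rw [h1, h2]
  congr 1
  ring

theorem Triv.ratio_eq (T T' : B.Triv) {k : K} (hk : k ∈ T.e.baseSet ∩ T'.e.baseSet) :
    T'.tau (B.pt k) / T.tau (B.pt k) =
      scale (T'.e (T.e.toOpenPartialHomeomorph.symm (k, 1))).2 := by
  set y := T.e.toOpenPartialHomeomorph.symm (k, 1) with hy
  have hyk : B.proj y = k := T.e.proj_symm_apply' hk.1
  have hτ : T.tau y = 1 := by
    rw [Triv.tau, hy, T.e.apply_symm_apply' hk.1]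
    rfl
  obtain ⟨s, hs⟩ := B.exists_smul_eq (hyk.trans (B.pt k).2.symm)
  rw [hs, T'.tau_smul (by rw [hyk]; exact hk.2), T.tau_smul (by rw [hyk]; exact hk.1), hτ, mul_one,
    mul_div_cancel_left₀ _ (scale_ne_zero s)]
  rfl

theorem Triv.contMDiffOn_ratio (T T' : B.Triv) :
    ContMDiffOn 𝓘(ℝ, EK) 𝓘(ℝ, ℝ) ∞ (fun k => T'.tau (B.pt k) / T.tau (B.pt k))
      (T.e.baseSet ∩ T'.e.baseSet) := by
  have h1 : ContMDiffOn 𝓘(ℝ, EK) 𝓘(ℝ, EP) ∞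
      (fun k => T.e.toOpenPartialHomeomorph.symm (k, (1 : G))) (T.e.baseSet ∩ T'.e.baseSet) :=
    T.smooth_symm.comp (contMDiff_id.prodMk contMDiff_const).contMDiffOn
      (fun k hk => by rw [T.e.target_eq]; exact ⟨hk.1, mem_univ _⟩)
  have h2 : ContMDiffOn 𝓘(ℝ, EK) (𝓘(ℝ, EK).prod 𝓘(ℝ, ℝ)) ∞
      (fun k => T'.e (T.e.toOpenPartialHomeomorph.symm (k, (1 : G))))
      (T.e.baseSet ∩ T'.e.baseSet) :=
    T'.smooth.comp h1 (fun k hk => by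
      rw [mem_preimage, T'.e.mem_source, T.e.proj_symm_apply' hk.1]; exact hk.2)
  refine ((contMDiff_scale.comp contMDiff_snd).comp_contMDiffOn h2).congr fun k hk => ?_
  exact T.ratio_eq T' hk

variable (B)

theorem exists_lineCoordChange (T T' : B.Triv) : ∃ f : K → ℝ →L[ℝ] ℝ,
    ContMDiffOn 𝓘(ℝ, EK) 𝓘(ℝ, ℝ →L[ℝ] ℝ) ∞ f (T.lineTriv.baseSet ∩ T'.lineTriv.baseSet) ∧
      ∀ k ∈ T.lineTriv.baseSet ∩ T'.lineTriv.baseSet, ∀ v : ℝ,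
        f k v = (T'.lineTriv ⟨k, T.lineTriv.symm k v⟩).2 := by
  refine ⟨fun k => (T'.tau (B.pt k) / T.tau (B.pt k)) • ContinuousLinearMap.id ℝ ℝ, ?_, ?_⟩
  · exact (T.contMDiffOn_ratio T').smul contMDiffOn_const
  · intro k hk v
    rw [T.lineTriv.symm_apply hk.1]
    change _ = T'.tau (B.pt k) *
      B.fiberLinearEquiv k ((B.fiberLinearEquiv k).symm (v / T.tau (B.pt k)))
    rw [LinearEquiv.apply_symm_apply]
    simp only [_root_.smul_apply, ContinuousLinearMap.id_apply, smul_eq_mul]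
    ring

/-- The vector bundle atlas of the associated line bundle. -/
def linePrebundle : VectorPrebundle ℝ ℝ B.LineFiber where
  pretrivializationAtlas := range (Triv.lineTriv (B := B))
  pretrivialization_linear' := by
    rintro _ ⟨T, rfl⟩
    refine ⟨fun k hk => ⟨fun x y => ?_, fun c x => ?_⟩⟩
    · change T.tau (B.pt k) * B.fiberLinearEquiv k (x + y) =
        T.tau (B.pt k) * B.fiberLinearEquiv k x + T.tau (B.pt k) * B.fiberLinearEquiv k y
      rw [map_add, mul_add]
    · change T.tau (B.pt k) * B.fiberLinearEquiv k (c • x) =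
        c • (T.tau (B.pt k) * B.fiberLinearEquiv k x)
      rw [map_smul, smul_eq_mul, smul_eq_mul]
      ring
  pretrivializationAt k := (B.exists_triv k).choose.lineTriv
  mem_base_pretrivializationAt k := (B.exists_triv k).choose_spec
  pretrivialization_mem_atlas k := ⟨_, rfl⟩
  exists_coordChange := by
    rintro _ ⟨T, rfl⟩ _ ⟨T', rfl⟩
    obtain ⟨f, hf, h⟩ := B.exists_lineCoordChange T T'
    exact ⟨f, hf.continuousOn, h⟩
  totalSpaceMk_isInducing k := by
    have h1 : IsInducing (B.fiberLinearEquiv k) := ⟨rfl⟩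
    have h2 : IsInducing (fun u : ℝ => (k, (B.exists_triv k).choose.tau (B.pt k) * u)) :=
      (isEmbedding_prodMkRight k).isInducing.comp
        (Homeomorph.mulLeft₀ _ ((B.exists_triv k).choose.tau_ne_zero (B.pt k))).isInducing
    exact h2.comp h1

instance instTopologicalSpaceLine : TopologicalSpace (TotalSpace ℝ B.LineFiber) :=
  B.linePrebundle.totalSpaceTopology

instance instFiberBundleLine : FiberBundle ℝ B.LineFiber :=
  B.linePrebundle.toFiberBundle

instance instVectorBundleLine : VectorBundle ℝ ℝ B.LineFiber :=
  B.linePrebundle.toVectorBundle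

/-- The associated line bundle is a smooth vector bundle over `K`. -/
instance instContMDiffVectorBundleLine :
    ContMDiffVectorBundle ∞ ℝ B.LineFiber 𝓘(ℝ, EK) :=
  haveI : B.linePrebundle.IsContMDiff 𝓘(ℝ, EK) ∞ :=
    ⟨by
      rintro _ ⟨T, rfl⟩ _ ⟨T', rfl⟩
      exact B.exists_lineCoordChange T T'⟩
  B.linePrebundle.contMDiffVectorBundle 𝓘(ℝ, EK)

/-- The dual line bundle `L^*`. -/
abbrev DualFiber (k : K) : Type _ := B.LineFiber k →L[ℝ] Bundle.Trivial K ℝ k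

/-- The space `Γ(L^*)` of smooth sections of the dual line bundle. -/
abbrev DualSection : Type _ := Cₛ^∞⟮𝓘(ℝ, EK); ℝ →L[ℝ] ℝ, B.DualFiber⟯

/-- The function `H_h : P → ℝ`, `H_h(x) = h(proj x)[x, 1]`, given by a section `h` of `L^*`. -/
def homFun (h : B.DualSection) (x : P) : ℝ := h (B.proj x) (B.lineMk x 1)

end ScalingBundle

/-! ## Vector fields, Kirillov brackets -/

/-- The differential of a real function. -/
def diff {E : Type*} [NormedAddCommGroup E] [NormedSpace ℝ E]
    {M : Type*} [TopologicalSpace M] [ChartedSpace E M] (f : M → ℝ) (x : M) :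
    TangentSpace 𝓘(ℝ, E) x →L[ℝ] ℝ :=
  mfderiv 𝓘(ℝ, E) 𝓘(ℝ, ℝ) f x

/-- Smooth vector fields. -/
abbrev SmoothVectorField (E : Type*) [NormedAddCommGroup E] [NormedSpace ℝ E]
    (M : Type*) [TopologicalSpace M] [ChartedSpace E M] [IsManifold 𝓘(ℝ, E) ∞ M] : Type _ :=
  Cₛ^∞⟮𝓘(ℝ, E); E, (TangentSpace 𝓘(ℝ, E) : M → Type _)⟯

section Kirillov

variable {E : Type*} [NormedAddCommGroup E] [NormedSpace ℝ E]
  {K : Type*} [TopologicalSpace K] [ChartedSpace E K]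
  {F : Type*} [NormedAddCommGroup F] [NormedSpace ℝ F]
  {V : K → Type*} [TopologicalSpace (TotalSpace F V)]
  [∀ k, AddCommGroup (V k)] [∀ k, Module ℝ (V k)] [∀ k, TopologicalSpace (V k)]
  [FiberBundle F V] [VectorBundle ℝ F V]

/-- The product `f h` of a smooth function and a smooth section. -/
def smulSection (f : C^∞⟮𝓘(ℝ, E), K; ℝ⟯) (h : Cₛ^∞⟮𝓘(ℝ, E); F, V⟯) : Cₛ^∞⟮𝓘(ℝ, E); F, V⟯ :=
  ⟨fun k => f k • h k, f.contMDiff.smul_section h.contMDiff⟩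

variable [IsManifold 𝓘(ℝ, E) ∞ K]

/-- `X` is a symbol of the operator `D` on sections:
`D (f h) = f D(h) + X(f) h`. -/
def IsSymbol (D : Cₛ^∞⟮𝓘(ℝ, E); F, V⟯ → Cₛ^∞⟮𝓘(ℝ, E); F, V⟯) (X : SmoothVectorField E K) : Prop :=
  ∀ (f : C^∞⟮𝓘(ℝ, E), K; ℝ⟯) (h : Cₛ^∞⟮𝓘(ℝ, E); F, V⟯) (k : K),
    D (smulSection f h) k = f k • D h k + diff f k (X k) • h k

variable (E F V) in
/-- A Kirillov bracket (local Lie algebra bracket) on the sections of the vector bundle `V`: a real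
Lie bracket such that `[·, h]` is a derivation with some symbol for every section `h`. -/
structure KirillovBracket where
  bracket : Cₛ^∞⟮𝓘(ℝ, E); F, V⟯ →ₗ[ℝ] Cₛ^∞⟮𝓘(ℝ, E); F, V⟯ →ₗ[ℝ] Cₛ^∞⟮𝓘(ℝ, E); F, V⟯
  bracket_self : ∀ h, bracket h h = 0
  jacobi : ∀ h₁ h₂ h₃, bracket (bracket h₁ h₂) h₃ + bracket (bracket h₂ h₃) h₁ +
    bracket (bracket h₃ h₁) h₂ = 0
  exists_symbol : ∀ h, ∃ X : SmoothVectorField E K, IsSymbol (fun h₁ => bracket h₁ h) X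

/-- The symbol `X_h` of the derivation `[·, h]`. -/
def KirillovBracket.symbol (κ : KirillovBracket E F V) (h : Cₛ^∞⟮𝓘(ℝ, E); F, V⟯) :
    SmoothVectorField E K :=
  (κ.exists_symbol h).choose

end Kirillov

/-! ## Poisson structures -/

section Poisson

variable (E : Type*) [NormedAddCommGroup E] [NormedSpace ℝ E]
  (P : Type*) [TopologicalSpace P] [ChartedSpace E P] [IsManifold 𝓘(ℝ, E) ∞ P]

/-- A smooth bivector field `Π` on `P`, given by the skew-symmetric bundle map `T^*P → TP`,
`α ↦ i(α)Π = Π(α, ·)`. -/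
structure Bivector where
  sharp : ∀ x : P, (TangentSpace 𝓘(ℝ, E) x →L[ℝ] Bundle.Trivial P ℝ x) →L[ℝ]
    TangentSpace 𝓘(ℝ, E) x
  contMDiff_sharp : ContMDiff 𝓘(ℝ, E) (𝓘(ℝ, E).prod 𝓘(ℝ, (E →L[ℝ] ℝ) →L[ℝ] E)) ∞
    (fun x => TotalSpace.mk' ((E →L[ℝ] ℝ) →L[ℝ] E)
      (E := fun x : P => (TangentSpace 𝓘(ℝ, E) x →L[ℝ] Bundle.Trivial P ℝ x) →L[ℝ]
        TangentSpace 𝓘(ℝ, E) x) x (sharp x))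
  skew : ∀ (x : P) (α β : TangentSpace 𝓘(ℝ, E) x →L[ℝ] ℝ), β (sharp x α) = -α (sharp x β)

variable {E P}

/-- The value `Π(α, β)` on covectors. -/
def Bivector.eval (Λ : Bivector E P) (x : P) (α β : TangentSpace 𝓘(ℝ, E) x →L[ℝ] ℝ) : ℝ :=
  β (Λ.sharp x α)

/-- The bracket `{F₁, F₂} = Π(dF₁, dF₂)`. -/
def Bivector.poissonBracket (Λ : Bivector E P) (F₁ F₂ : P → ℝ) (x : P) : ℝ :=
  Λ.eval x (diff F₁ x) (diff F₂ x)

/-- The Hamiltonian vector field `X_H = -i(dH)Π = Π(·, dH)`, so that `X_H(F) = {F, H}`. -/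
def Bivector.hamiltonian (Λ : Bivector E P) (H : P → ℝ) (x : P) : TangentSpace 𝓘(ℝ, E) x :=
  -Λ.sharp x (diff H x)

/-- `Π` is a Poisson structure: its bracket of smooth functions satisfies the Jacobi identity. -/
def Bivector.IsPoisson (Λ : Bivector E P) : Prop :=
  ∀ F₁ F₂ F₃ : C^∞⟮𝓘(ℝ, E), P; ℝ⟯, ∀ x : P,
    Λ.poissonBracket (Λ.poissonBracket F₁ F₂) F₃ x +
      Λ.poissonBracket (Λ.poissonBracket F₂ F₃) F₁ x +
      Λ.poissonBracket (Λ.poissonBracket F₃ F₁) F₂ x = 0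

variable (G : OpenSubgroup ℝˣ) [MulAction G P]

/-- `∧²Tφ_s ∘ Π = s Π ∘ φ_s` for the action `φ_s x = s • x`, tested on pairs of covectors. -/
def Bivector.IsHomogeneous (Λ : Bivector E P) : Prop :=
  ∀ (s : G) (x : P) (α β : TangentSpace 𝓘(ℝ, E) (s • x) →L[ℝ] ℝ),
    Λ.eval x (α.comp (mfderiv 𝓘(ℝ, E) 𝓘(ℝ, E) (fun y : P => s • y) x))
        (β.comp (mfderiv 𝓘(ℝ, E) 𝓘(ℝ, E) (fun y : P => s • y) x)) =
      scale s * Λ.eval (s • x) α β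

variable (E P) in
/-- The smooth homogeneous functions: `H ∘ φ_s = s H`. -/
def homogeneousFunctions : Set (P → ℝ) :=
  {H | ContMDiff 𝓘(ℝ, E) 𝓘(ℝ, ℝ) ∞ H ∧ ∀ (s : G) (x : P), H (s • x) = scale s * H x}

end Poisson

end ScalingReduction

end

open ScalingReduction

/-! Degree-one homogeneous functions on `P` are sections of `L^*` in disguise: `[s • x, 1] = [x,
s]`, so evaluating a fibrewise linear functional on `[x, 1]` gives a function that scales by `s`.
Conversely, such a function prescribes the functional on the spanning vector `[x, 1]` of each fibre,
consistently along orbits; smoothness is seen in a local trivialization (`bijOn_homFun`).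

Homogeneity of `Π` reads `{F ∘ φ_s, H ∘ φ_s} = s {F, H} ∘ φ_s`. If `F` and `H` both have degree one,
the left side is `s² {F, H}`, so `{F, H}` has degree one again (`IsHomogeneous.poissonBracket_mem`).
The bracket therefore transports to `Γ(L^*)`, with Jacobi and skew-symmetry. If `F` is invariant,
the left side is `s {F, H}`, so `{F, H}` is invariant
(`IsHomogeneous.poissonBracket_smul_of_invariant`). Applied to `F = f ∘ p`, this makes the
Hamiltonian field of `H` projectable, and the Leibniz rule for `{(f ∘ p) H_{h₁}, H_h}` shows that
minus its projection is the symbol of `[·, h]` (`isSymbol_neg_projField`).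

Symbols are unique because some section is nonzero at each given point and functions separate
tangent vectors. Part (d) needs no Poisson structure: a commutator of derivations has the commutator
of the symbols as symbol (`IsSymbol.commutator`), and by Jacobi the commutator of `[·, h₁]` and `[·,
h₂]` is `-[·, [h₁, h₂]]`. -/

noncomputable section

namespace ScalingReduction

/-! ### Differentials of functions and commutators of vector fields -/

section Differential

variable {E : Type*} [NormedAddCommGroup E] [NormedSpace ℝ E]
  {M : Type*} [TopologicalSpace M] [ChartedSpace E M]

theorem diff_add {f g : M → ℝ} {x : M} (hf : MDifferentiableAt 𝓘(ℝ, E) 𝓘(ℝ, ℝ) f x)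
    (hg : MDifferentiableAt 𝓘(ℝ, E) 𝓘(ℝ, ℝ) g x) :
    diff (E := E) (f + g) x = diff f x + diff g x :=
  mfderiv_add hf hg

theorem diff_neg (f : M → ℝ) (x : M) : diff (E := E) (-f) x = -diff f x :=
  mfderiv_neg

theorem diff_const_smul {f : M → ℝ} {x : M} (hf : MDifferentiableAt 𝓘(ℝ, E) 𝓘(ℝ, ℝ) f x) (c : ℝ) :
    diff (E := E) (c • f) x = c • diff f x :=
  const_smul_mfderiv hf c

theorem diff_mul {f g : M → ℝ} {x : M} (hf : MDifferentiableAt 𝓘(ℝ, E) 𝓘(ℝ, ℝ) f x)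
    (hg : MDifferentiableAt 𝓘(ℝ, E) 𝓘(ℝ, ℝ) g x) :
    diff (E := E) (f * g) x = f x • diff g x + g x • diff f x :=
  (hf.hasMFDerivAt.mul hg.hasMFDerivAt).mfderiv

theorem diff_comp {E' : Type*} [NormedAddCommGroup E'] [NormedSpace ℝ E']
    {M' : Type*} [TopologicalSpace M'] [ChartedSpace E' M'] {f : M' → ℝ} {p : M → M'} {x : M}
    (hf : MDifferentiableAt 𝓘(ℝ, E') 𝓘(ℝ, ℝ) f (p x))
    (hp : MDifferentiableAt 𝓘(ℝ, E) 𝓘(ℝ, E') p x) :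
    diff (f ∘ p) x = (diff f (p x)).comp (mfderiv 𝓘(ℝ, E) 𝓘(ℝ, E') p x) :=
  mfderiv_comp x hf hp

/-- `mfderiv` at `x` is computed in the preferred chart at `x`, so the formula is available only at
the centre of that chart. -/
theorem diff_apply_eq_fderiv {f : M → ℝ} {x : M} (hf : MDifferentiableAt 𝓘(ℝ, E) 𝓘(ℝ, ℝ) f x)
    (v : TangentSpace 𝓘(ℝ, E) x) :
    diff f x v = fderiv ℝ (f ∘ (extChartAt 𝓘(ℝ, E) x).symm) (extChartAt 𝓘(ℝ, E) x x) v := by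
  rw [diff, hf.mfderiv, ← fderivWithin_univ, writtenInExtChartAt]
  simp only [modelWithCornersSelf_coe, range_id]
  rfl

variable [IsManifold 𝓘(ℝ, E) ∞ M]

/-- Every covector is the differential of a globally defined smooth function. -/
theorem exists_diff_eq [FiniteDimensional ℝ E] [T2Space M] (x : M)
    (l : TangentSpace 𝓘(ℝ, E) x →L[ℝ] ℝ) :
    ∃ f : C^∞⟮𝓘(ℝ, E), M; ℝ⟯, diff f x = l := by
  let χ : SmoothBumpFunction 𝓘(ℝ, E) x := Classical.arbitrary _
  let l' : E →L[ℝ] ℝ := l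
  have hg : ContMDiffOn 𝓘(ℝ, E) 𝓘(ℝ, ℝ) ∞ (fun y => l' (extChartAt 𝓘(ℝ, E) x y))
      (chartAt E x).source :=
    l'.contMDiff.comp_contMDiffOn contMDiffOn_extChartAt
  refine ⟨⟨_, χ.contMDiff_smul hg⟩, ?_⟩
  -- The cutoff is 1 near `x`, so it does not affect the differential there, and the chart at `x`
  -- has identity derivative at `x`.
  have heq : (fun y => χ y • l' (extChartAt 𝓘(ℝ, E) x y)) =ᶠ[𝓝 x]
      l' ∘ extChartAt 𝓘(ℝ, E) x := by
    filter_upwards [χ.eventuallyEq_one] with y hy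
    simp [hy]
  refine heq.mfderiv_eq.trans ?_
  rw [mfderiv_comp (I' := 𝓘(ℝ, E)) x l'.mdifferentiableAt
    (mdifferentiableAt_extChartAt (mem_chart_source E x)), mfderiv_extChartAt_self]
  rw [l'.mfderiv_eq]
  rfl

/-- Covectors separate vectors and all of them are differentials. Equalities of vectors on the base
are checked on functions in this way. -/
theorem eq_of_forall_diff_eq [FiniteDimensional ℝ E] [T2Space M] {x : M}
    {v w : TangentSpace 𝓘(ℝ, E) x} (h : ∀ f : C^∞⟮𝓘(ℝ, E), M; ℝ⟯, diff f x v = diff f x w) :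
    v = w := by
  refine SeparatingDual.eq_iff_forall_dual_eq (R := ℝ) (V := E) |>.2 fun l => ?_
  obtain ⟨f, hf⟩ := exists_diff_eq x l
  have := h f
  rwa [hf] at this

/-- The differential of a smooth function is a smooth section of the cotangent bundle. -/
theorem contMDiff_diff {f : M → ℝ} (hf : ContMDiff 𝓘(ℝ, E) 𝓘(ℝ, ℝ) ∞ f) :
    ContMDiff 𝓘(ℝ, E) (𝓘(ℝ, E).prod 𝓘(ℝ, E →L[ℝ] ℝ)) ∞
      (fun x => TotalSpace.mk' (E →L[ℝ] ℝ)
        (E := fun x : M => TangentSpace 𝓘(ℝ, E) x →L[ℝ] Bundle.Trivial M ℝ x) x (diff f x)) := by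
  intro x
  rw [contMDiffAt_hom_bundle]
  refine ⟨contMDiffAt_id, ?_⟩
  have h := (hf x).mfderiv_const (m := ∞) (by simp)
  refine h.congr_of_eventuallyEq (Filter.Eventually.of_forall fun y => ?_)
  simp only [inTangentCoordinates, ContinuousLinearMap.inCoordinates]
  rw [TangentBundle.continuousLinearMapAt_model_space]
  have h1 : Trivialization.continuousLinearMapAt ℝ (trivializationAt ℝ (Bundle.Trivial M ℝ) x) y =
      ContinuousLinearMap.id ℝ ℝ := Bundle.Trivial.continuousLinearMapAt_trivialization ..
  ext v
  exact DFunLike.congr_fun h1 _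

theorem contMDiff_diff_apply {f : M → ℝ} (hf : ContMDiff 𝓘(ℝ, E) 𝓘(ℝ, ℝ) ∞ f)
    {V : ∀ x : M, TangentSpace 𝓘(ℝ, E) x}
    (hV : ContMDiff 𝓘(ℝ, E) (𝓘(ℝ, E).prod 𝓘(ℝ, E)) ∞ (fun x => TotalSpace.mk' E x (V x))) :
    ContMDiff 𝓘(ℝ, E) 𝓘(ℝ, ℝ) ∞ (fun x => diff f x (V x)) := fun x =>
  (contMDiffAt_totalSpace.1 ((contMDiff_diff hf).clm_bundle_apply hV x)).2

/-- Chain rule: the pullback applies the inverse of the derivative of the inverse chart, which then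
cancels. Validity on the whole chart target, not only at its centre, is what allows differentiating
once more. -/
theorem fderiv_comp_extChartAt_symm {f : M → ℝ} (hf : ContMDiff 𝓘(ℝ, E) 𝓘(ℝ, ℝ) ∞ f)
    (W : ∀ x : M, TangentSpace 𝓘(ℝ, E) x) {x : M} {y : E}
    (hy : y ∈ (extChartAt 𝓘(ℝ, E) x).target) :
    fderiv ℝ (f ∘ (extChartAt 𝓘(ℝ, E) x).symm) y
        (VectorField.mpullbackWithin 𝓘(ℝ, E) 𝓘(ℝ, E) (extChartAt 𝓘(ℝ, E) x).symm W
          (range 𝓘(ℝ, E)) y) =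
      diff f ((extChartAt 𝓘(ℝ, E) x).symm y) (W ((extChartAt 𝓘(ℝ, E) x).symm y)) := by
  have hinv := isInvertible_mfderivWithin_extChartAt_symm (I := 𝓘(ℝ, E)) hy
  have hd := mdifferentiableWithinAt_extChartAt_symm (I := 𝓘(ℝ, E)) hy
  have hcomp := mfderiv_comp_mfderivWithin y
    ((hf ((extChartAt 𝓘(ℝ, E) x).symm y)).mdifferentiableAt (by simp)) hd
      (by simp [UniqueMDiffWithinAt, uniqueDiffWithinAt_univ])
  have h1 : mfderivWithin 𝓘(ℝ, E) 𝓘(ℝ, ℝ) (f ∘ (extChartAt 𝓘(ℝ, E) x).symm) (range 𝓘(ℝ, E)) y =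
      fderiv ℝ (f ∘ (extChartAt 𝓘(ℝ, E) x).symm) y := by
    rw [mfderivWithin_eq_fderivWithin, modelWithCornersSelf_coe, range_id, fderivWithin_univ]
  rw [← h1, hcomp, VectorField.mpullbackWithin_apply]
  exact congrArg (diff f _) (hinv.self_apply_inverse _)

/-- A commutator of vector fields acts on functions as the commutator of derivations. -/
theorem diff_mlieBracket [CompleteSpace E] {f : M → ℝ} (hf : ContMDiff 𝓘(ℝ, E) 𝓘(ℝ, ℝ) ∞ f)
    (V W : SmoothVectorField E M) (x : M) :
    diff f x (VectorField.mlieBracket 𝓘(ℝ, E) V W x) =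
      diff (fun y => diff f y (W y)) x (V x) - diff (fun y => diff f y (V y)) x (W x) := by
  have hV := (contMDiff_diff_apply hf V.contMDiff).mdifferentiable (by simp)
  have hW := (contMDiff_diff_apply hf W.contMDiff).mdifferentiable (by simp)
  set φ := extChartAt 𝓘(ℝ, E) x with hφ
  set V' : E → E := VectorField.mpullbackWithin 𝓘(ℝ, E) 𝓘(ℝ, E) φ.symm V (range 𝓘(ℝ, E))
  set W' : E → E := VectorField.mpullbackWithin 𝓘(ℝ, E) 𝓘(ℝ, E) φ.symm W (range 𝓘(ℝ, E))
  have hset : φ.symm ⁻¹' univ ∩ range 𝓘(ℝ, E) = univ := by simp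
  -- The chart at `x` has identity derivative at `x`, so the bracket at `x` is the bracket of the
  -- chart representatives in the model space.
  have hbr : VectorField.mlieBracket 𝓘(ℝ, E) V W x = VectorField.lieBracket ℝ V' W' (φ x) := by
    rw [← VectorField.mlieBracketWithin_univ, VectorField.mlieBracketWithin_apply,
      mfderiv_extChartAt_self]
    refine (congrArg (fun A : E →L[ℝ] E => A _) (ContinuousLinearMap.inverse_id (R := ℝ) (M := E))).trans ?_
    rw [← VectorField.lieBracketWithin_univ, ← hset]
    rfl
  have hdiff : ∀ U : SmoothVectorField E M, DifferentiableAt ℝ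
      (VectorField.mpullbackWithin 𝓘(ℝ, E) 𝓘(ℝ, E) φ.symm U (range 𝓘(ℝ, E)) : E → E) (φ x) := by
    intro U
    have := (U.mdifferentiableAt (x := x)).mdifferentiableWithinAt (s := univ)
      |>.differentiableWithinAt_mpullbackWithin_vectorField
    rw [← hφ, hset] at this
    exact differentiableWithinAt_univ.1 this
  have hval : ∀ U : SmoothVectorField E M,
      (VectorField.mpullbackWithin 𝓘(ℝ, E) 𝓘(ℝ, E) φ.symm U (range 𝓘(ℝ, E)) (φ x) : E) = U x := by
    intro U
    rw [VectorField.mpullbackWithin_apply, hφ]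
    rw [extChartAt_to_inv]
    exact mfderivWithin_extChartAt_symm_inverse_apply (I := 𝓘(ℝ, E)) (U x)
  have hev : ∀ U : SmoothVectorField E M, (fun y => fderiv ℝ (f ∘ φ.symm) y
      (VectorField.mpullbackWithin 𝓘(ℝ, E) 𝓘(ℝ, E) φ.symm U (range 𝓘(ℝ, E)) y)) =ᶠ[𝓝 (φ x)]
        (fun y => diff f y (U y)) ∘ φ.symm := by
    intro U
    filter_upwards [extChartAt_target_mem_nhds (I := 𝓘(ℝ, E)) x] with y hy
    exact fderiv_comp_extChartAt_symm hf U hy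
  have hf' : ContDiffAt ℝ ∞ (f ∘ φ.symm) (φ x) := by
    have := (hf (φ.symm (φ x))).comp (φ x)
      ((contMDiffOn_extChartAt_symm (I := 𝓘(ℝ, E)) (n := ∞) x).contMDiffAt
        (extChartAt_target_mem_nhds x))
    exact this.contDiffAt
  -- What remains is the identity in the model space, where the second-derivative terms of `f ∘
  -- φ.symm` cancel by symmetry.
  rw [diff_apply_eq_fderiv (hf.mdifferentiable (by simp) x), diff_apply_eq_fderiv (hW x),
    diff_apply_eq_fderiv (hV x), ← hφ, hbr,
    VectorField.fderiv_apply_lieBracket hf' (by simpa using ENat.LEInfty.out) (hdiff W) (hdiff V)]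
  rw [(hev W).fderiv_eq, (hev V).fderiv_eq, hval V, hval W]

end Differential

/-! ### Poisson brackets and their scaling behaviour -/

section Poisson

variable {E : Type*} [NormedAddCommGroup E] [NormedSpace ℝ E]
  {P : Type*} [TopologicalSpace P] [ChartedSpace E P] [IsManifold 𝓘(ℝ, E) ∞ P]

namespace Bivector

theorem contMDiff_hamiltonian (Λ : Bivector E P) {H : P → ℝ}
    (hH : ContMDiff 𝓘(ℝ, E) 𝓘(ℝ, ℝ) ∞ H) :
    ContMDiff 𝓘(ℝ, E) (𝓘(ℝ, E).prod 𝓘(ℝ, E)) ∞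
      (fun x => TotalSpace.mk' E (E := (TangentSpace 𝓘(ℝ, E) : P → Type _)) x
        (Λ.hamiltonian H x)) :=
  (Λ.contMDiff_sharp.clm_bundle_apply (contMDiff_diff hH)).neg_section

/-- Skew-symmetry absorbs the sign in `hamiltonian`. Rules in the first argument thus reduce to
rules for `diff`; those in the second follow by `poissonBracket_swap`. -/
theorem poissonBracket_eq_diff_hamiltonian (Λ : Bivector E P) (F H : P → ℝ) (x : P) :
    Λ.poissonBracket F H x = diff F x (Λ.hamiltonian H x) := by
  rw [poissonBracket, eval, Λ.skew, hamiltonian, map_neg]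

theorem contMDiff_poissonBracket (Λ : Bivector E P) {F H : P → ℝ}
    (hF : ContMDiff 𝓘(ℝ, E) 𝓘(ℝ, ℝ) ∞ F) (hH : ContMDiff 𝓘(ℝ, E) 𝓘(ℝ, ℝ) ∞ H) :
    ContMDiff 𝓘(ℝ, E) 𝓘(ℝ, ℝ) ∞ (Λ.poissonBracket F H) :=
  (contMDiff_diff_apply hF (Λ.contMDiff_hamiltonian hH)).congr
    fun x => Λ.poissonBracket_eq_diff_hamiltonian F H x

theorem poissonBracket_swap (Λ : Bivector E P) (F H : P → ℝ) :
    Λ.poissonBracket F H = -Λ.poissonBracket H F :=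
  funext fun x => Λ.skew x _ _

theorem poissonBracket_self (Λ : Bivector E P) (F : P → ℝ) : Λ.poissonBracket F F = 0 := by
  have h := Λ.poissonBracket_swap F F
  exact self_eq_neg.1 h

theorem poissonBracket_add_left (Λ : Bivector E P) {F₁ F₂ : P → ℝ} (H : P → ℝ)
    (h₁ : ContMDiff 𝓘(ℝ, E) 𝓘(ℝ, ℝ) ∞ F₁) (h₂ : ContMDiff 𝓘(ℝ, E) 𝓘(ℝ, ℝ) ∞ F₂) :
    Λ.poissonBracket (F₁ + F₂) H = Λ.poissonBracket F₁ H + Λ.poissonBracket F₂ H := by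
  ext x
  simp only [poissonBracket_eq_diff_hamiltonian, Pi.add_apply,
    diff_add (h₁.mdifferentiable (by simp) x) (h₂.mdifferentiable (by simp) x)]
  rfl

theorem poissonBracket_smul_left (Λ : Bivector E P) (c : ℝ) {F : P → ℝ} (H : P → ℝ)
    (hF : ContMDiff 𝓘(ℝ, E) 𝓘(ℝ, ℝ) ∞ F) :
    Λ.poissonBracket (c • F) H = c • Λ.poissonBracket F H := by
  ext x
  simp only [poissonBracket_eq_diff_hamiltonian, Pi.smul_apply,
    diff_const_smul (hF.mdifferentiable (by simp) x)]
  rfl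

theorem poissonBracket_mul_left (Λ : Bivector E P) {F₁ F₂ : P → ℝ} (H : P → ℝ)
    (h₁ : ContMDiff 𝓘(ℝ, E) 𝓘(ℝ, ℝ) ∞ F₁) (h₂ : ContMDiff 𝓘(ℝ, E) 𝓘(ℝ, ℝ) ∞ F₂) (x : P) :
    Λ.poissonBracket (F₁ * F₂) H x =
      F₁ x * Λ.poissonBracket F₂ H x + Λ.poissonBracket F₁ H x * F₂ x := by
  simp only [poissonBracket_eq_diff_hamiltonian,
    diff_mul (h₁.mdifferentiable (by simp) x) (h₂.mdifferentiable (by simp) x)]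
  rw [mul_comm _ (F₂ x)]
  rfl

theorem poissonBracket_neg_left (Λ : Bivector E P) (F H : P → ℝ) :
    Λ.poissonBracket (-F) H = -Λ.poissonBracket F H := by
  ext x
  simp only [poissonBracket_eq_diff_hamiltonian, Pi.neg_apply, diff_neg]
  rfl

theorem poissonBracket_add_right (Λ : Bivector E P) {F₁ F₂ : P → ℝ} (H : P → ℝ)
    (h₁ : ContMDiff 𝓘(ℝ, E) 𝓘(ℝ, ℝ) ∞ F₁) (h₂ : ContMDiff 𝓘(ℝ, E) 𝓘(ℝ, ℝ) ∞ F₂) :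
    Λ.poissonBracket H (F₁ + F₂) = Λ.poissonBracket H F₁ + Λ.poissonBracket H F₂ := by
  rw [poissonBracket_swap, poissonBracket_add_left Λ H h₁ h₂, neg_add, ← poissonBracket_swap,
    ← poissonBracket_swap]

theorem poissonBracket_smul_right (Λ : Bivector E P) (c : ℝ) {F : P → ℝ} (H : P → ℝ)
    (hF : ContMDiff 𝓘(ℝ, E) 𝓘(ℝ, ℝ) ∞ F) :
    Λ.poissonBracket H (c • F) = c • Λ.poissonBracket H F := by
  rw [poissonBracket_swap, poissonBracket_smul_left Λ c H hF, ← smul_neg, ← poissonBracket_swap]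

variable {G : OpenSubgroup ℝˣ} [MulAction G P] {Λ : Bivector E P}

/-- Homogeneity of `Π` tested on the covectors `dF` and `dH` at `s • x`, whose pullbacks are, by the
chain rule, the differentials of the composed functions. -/
theorem IsHomogeneous.poissonBracket_comp_smul (hG : Λ.IsHomogeneous G)
    {F H : P → ℝ} (hF : ContMDiff 𝓘(ℝ, E) 𝓘(ℝ, ℝ) ∞ F) (hH : ContMDiff 𝓘(ℝ, E) 𝓘(ℝ, ℝ) ∞ H)
    {s : G} (hs : ContMDiff 𝓘(ℝ, E) 𝓘(ℝ, E) ∞ (fun y : P => s • y)) (x : P) :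
    Λ.poissonBracket (F ∘ fun y => s • y) (H ∘ fun y => s • y) x =
      scale s * Λ.poissonBracket F H (s • x) := by
  have h := hG s x (diff F (s • x)) (diff H (s • x))
  rw [poissonBracket, diff_comp (p := fun y : P => s • y) (hF.mdifferentiable (by simp) _)
    (hs.mdifferentiable (by simp) x), diff_comp (p := fun y : P => s • y)
    (hH.mdifferentiable (by simp) _) (hs.mdifferentiable (by simp) x)]
  exact h

/-- The bracket of homogeneous functions of degree one is homogeneous of degree one. -/
theorem IsHomogeneous.poissonBracket_mem (hG : Λ.IsHomogeneous G)
    (hs : ∀ s : G, ContMDiff 𝓘(ℝ, E) 𝓘(ℝ, E) ∞ (fun y : P => s • y))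
    {F H : P → ℝ} (hF : F ∈ homogeneousFunctions E P G) (hH : H ∈ homogeneousFunctions E P G) :
    Λ.poissonBracket F H ∈ homogeneousFunctions E P G := by
  refine ⟨Λ.contMDiff_poissonBracket hF.1 hH.1, fun s x => ?_⟩
  have h := hG.poissonBracket_comp_smul hF.1 hH.1 (hs s) x
  have hF' : (F ∘ fun y => s • y) = scale s • F := funext (hF.2 s)
  have hH' : (H ∘ fun y => s • y) = scale s • H := funext (hH.2 s)
  -- The left side becomes `s · s · {F, H}(x)`, the right side is `s · {F, H}(s • x)`; one factor
  -- `s` cancels.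
  rw [hF', hH', Λ.poissonBracket_smul_left _ _ hF.1, Λ.poissonBracket_smul_right _ _ hH.1] at h
  exact (mul_left_cancel₀ (scale_ne_zero s) h).symm

/-- The bracket of an invariant function with a homogeneous one is invariant. -/
theorem IsHomogeneous.poissonBracket_smul_of_invariant (hG : Λ.IsHomogeneous G)
    (hs : ∀ s : G, ContMDiff 𝓘(ℝ, E) 𝓘(ℝ, E) ∞ (fun y : P => s • y))
    {F H : P → ℝ} (hF : ContMDiff 𝓘(ℝ, E) 𝓘(ℝ, ℝ) ∞ F) (hF' : ∀ (s : G) (x : P), F (s • x) = F x)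
    (hH : H ∈ homogeneousFunctions E P G) (s : G) (x : P) :
    Λ.poissonBracket F H (s • x) = Λ.poissonBracket F H x := by
  have h := hG.poissonBracket_comp_smul hF hH.1 (hs s) x
  have hF' : (F ∘ fun y => s • y) = F := funext (hF' s)
  have hH' : (H ∘ fun y => s • y) = scale s • H := funext (hH.2 s)
  rw [hF', hH', Λ.poissonBracket_smul_right _ _ hH.1] at h
  exact (mul_left_cancel₀ (scale_ne_zero s) h).symm

end Bivector

end Poisson

/-! ### Sections of the dual line bundle as homogeneous functions -/

namespace ScalingBundle

variable {G : OpenSubgroup ℝˣ}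
  {EP : Type*} [NormedAddCommGroup EP] [NormedSpace ℝ EP]
  {P : Type*} [TopologicalSpace P] [ChartedSpace EP P] [MulAction G P]
  {EK : Type*} [NormedAddCommGroup EK] [NormedSpace ℝ EK]
  {K : Type*} [TopologicalSpace K] [ChartedSpace EK K]
  (B : ScalingBundle G EP P EK K)

theorem contMDiff_const_smul (B : ScalingBundle G EP P EK K) (s : G) :
    ContMDiff 𝓘(ℝ, EP) 𝓘(ℝ, EP) ∞ (fun x : P => s • x) :=
  B.contMDiff_smul.comp (contMDiff_const.prodMk contMDiff_id)

/-- Smoothness of the projection is not a field of `ScalingBundle`: it holds because the projection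
is locally the first component of a smooth trivialization. -/
theorem contMDiff_proj : ContMDiff 𝓘(ℝ, EP) 𝓘(ℝ, EK) ∞ B.proj := by
  intro x
  obtain ⟨T, hT⟩ := B.exists_triv (B.proj x)
  have hx : x ∈ T.e.source := T.e.mem_source.2 hT
  have h := contMDiffAt_fst.comp x (T.smooth.contMDiffAt (T.e.open_source.mem_nhds hx))
  refine h.congr_of_eventuallyEq ?_
  filter_upwards [T.e.open_source.mem_nhds hx] with y hy
  exact (T.e.coe_fst hy).symm

variable {B}

/-- The local section of the principal bundle given by a local trivialization. -/
def Triv.sec (T : B.Triv) (k : K) : P := T.e.toOpenPartialHomeomorph.symm (k, 1)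

theorem Triv.proj_sec (T : B.Triv) {k : K} (hk : k ∈ T.e.baseSet) : B.proj (T.sec k) = k :=
  T.e.proj_symm_apply' hk

theorem Triv.tau_sec (T : B.Triv) {k : K} (hk : k ∈ T.e.baseSet) : T.tau (T.sec k) = 1 := by
  rw [Triv.tau, Triv.sec, T.e.apply_symm_apply' hk]
  rfl

theorem Triv.contMDiffOn_sec (T : B.Triv) :
    ContMDiffOn 𝓘(ℝ, EK) 𝓘(ℝ, EP) ∞ T.sec T.e.baseSet :=
  T.smooth_symm.comp (contMDiff_id.prodMk contMDiff_const).contMDiffOn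
    (fun k hk => by rw [T.e.target_eq]; exact ⟨hk, mem_univ _⟩)

theorem Triv.contMDiffOn_tau (T : B.Triv) :
    ContMDiffOn 𝓘(ℝ, EP) 𝓘(ℝ, ℝ) ∞ T.tau T.e.source :=
  (contMDiff_scale.comp contMDiff_snd).comp_contMDiffOn T.smooth

variable (B)

theorem contMDiff_lineMk (t : ℝ) : ContMDiff 𝓘(ℝ, EP) (𝓘(ℝ, EK).prod 𝓘(ℝ, ℝ)) ∞
    (fun x => TotalSpace.mk' ℝ (E := B.LineFiber) (B.proj x) (B.lineMk x t)) := by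
  intro x
  rw [contMDiffAt_totalSpace]
  refine ⟨B.contMDiff_proj x, ?_⟩
  -- This particular choice defines the preferred trivialization of `L` at this point, in which `[y,
  -- t]` has coordinate `t * τ(y)`.
  set T := (B.exists_triv (B.proj x)).choose
  have hT : B.proj x ∈ T.e.baseSet := (B.exists_triv (B.proj x)).choose_spec
  have hx : x ∈ T.e.source := T.e.mem_source.2 hT
  have h : ContMDiffAt 𝓘(ℝ, EP) 𝓘(ℝ, ℝ) ∞ (fun y => t * T.tau y) x :=
    contMDiffAt_const.mul (T.contMDiffOn_tau.contMDiffAt (T.e.open_source.mem_nhds hx))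
  refine h.congr_of_eventuallyEq ?_
  filter_upwards [T.e.open_source.mem_nhds hx] with y hy
  exact congrArg Prod.snd (T.lineTriv_mk (T.e.mem_source.1 hy) t)

theorem contMDiff_homFun (h : B.DualSection) : ContMDiff 𝓘(ℝ, EP) 𝓘(ℝ, ℝ) ∞ (B.homFun h) :=
  fun x => (contMDiffAt_totalSpace.1
    ((h.contMDiff.comp B.contMDiff_proj).clm_bundle_apply (B.contMDiff_lineMk 1) x)).2

theorem apply_lineMk (h : B.DualSection) (x : P) (t : ℝ) :
    h (B.proj x) (B.lineMk x t) = t * B.homFun h x := by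
  have h1 : B.lineMk x t = t • B.lineMk x 1 := by
    rw [lineMk, lineMk, B.smul_fiberMk, mul_one]
  rw [h1]
  exact map_smul (h (B.proj x)) t (B.lineMk x 1)

theorem homFun_mem (h : B.DualSection) : B.homFun h ∈ homogeneousFunctions EP P G := by
  refine ⟨B.contMDiff_homFun h, fun s x => ?_⟩
  rw [← B.apply_lineMk]
  -- The fibres over `proj (s • x)` and `proj x` are equal only propositionally, so `[s • x, 1] =
  -- [x, s]` is stated over a common base point `k`.
  have aux : ∀ (k : K) (hx : B.proj x = k) (hy : B.proj (s • x) = k),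
      h k (B.fiberMk ⟨s • x, hy⟩ 1) = h k (B.fiberMk ⟨x, hx⟩ (scale s)) := by
    intro k hx hy
    rw [B.fiberMk_smul (x := ⟨x, hx⟩) (y := ⟨s • x, hy⟩) (s := s) rfl, mul_one]
  have aux2 : ∀ (k : K) (hy : B.proj (s • x) = k),
      B.homFun h (s • x) = h k (B.fiberMk ⟨s • x, hy⟩ 1) := by
    rintro k rfl
    rfl
  rw [aux2 _ (B.proj_smul s x), aux _ rfl]
  rfl

theorem lineMk_surjective (x : P) (l : B.LineFiber (B.proj x)) : ∃ t, B.lineMk x t = l :=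
  (B.fiberMk_bijective ⟨x, rfl⟩).2 l

/-- The value of a section at a point is determined by the homogeneous function at one point of
the fibre. -/
theorem dual_ext {x : P} {a b : B.DualFiber (B.proj x)}
    (hab : a (B.lineMk x 1) = b (B.lineMk x 1)) : a = b := by
  ext l
  obtain ⟨t, rfl⟩ := B.lineMk_surjective x l
  have h1 : B.lineMk x t = t • B.lineMk x 1 := by
    rw [lineMk, lineMk, B.smul_fiberMk, mul_one]
  rw [h1]
  refine (map_smul a t _).trans (Eq.trans ?_ (map_smul b t _).symm)
  rw [hab]

theorem homFun_injective : Function.Injective B.homFun := by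
  intro h₁ h₂ h
  ext1 k
  obtain ⟨x, rfl⟩ := B.proj_surjective k
  exact B.dual_ext (congrFun h x)

/-- `fiberLinearEquiv` as a continuous linear map. -/
def fiberCLM (k : K) : B.DualFiber k where
  toLinearMap := (B.fiberLinearEquiv k).toLinearMap
  cont := continuous_induced_dom

/-- The section of `L^*` determined by a homogeneous function, as a function. -/
def dualFun (H : P → ℝ) (k : K) : B.DualFiber k := H (B.pt k) • B.fiberCLM k

variable {B}

/-- In a trivialization `x` equals `τ(x)` times the local section at `proj x`, so a homogeneous
function is determined by its restriction to the section. -/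
theorem Triv.eq_tau_mul (T : B.Triv) {H : P → ℝ} (hH : ∀ (s : G) (x : P), H (s • x) = scale s * H x)
    {x : P} (hx : B.proj x ∈ T.e.baseSet) : H x = T.tau x * H (T.sec (B.proj x)) := by
  obtain ⟨s, hs⟩ := B.exists_smul_eq (T.proj_sec hx)
  have hy : B.proj (T.sec (B.proj x)) ∈ T.e.baseSet := by rwa [T.proj_sec hx]
  have h1 : T.tau x = scale s := by
    conv_lhs => rw [hs]
    rw [T.tau_smul hy, T.tau_sec hx, mul_one]
  rw [h1, ← hH, ← hs]

variable (B)

/-- The base points `pt k` may vary discontinuously, but a change of `pt k` scales `H (pt k)` and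
`fiberCLM` by inverse factors. In the preferred trivialization the coefficient is `H ∘ T.sec`, which
is smooth. -/
theorem contMDiff_dualFun {H : P → ℝ} (hH : H ∈ homogeneousFunctions EP P G) :
    ContMDiff 𝓘(ℝ, EK) (𝓘(ℝ, EK).prod 𝓘(ℝ, ℝ →L[ℝ] ℝ)) ∞
      (fun k => TotalSpace.mk' (ℝ →L[ℝ] ℝ) (E := B.DualFiber) k (B.dualFun H k)) := by
  intro k
  rw [contMDiffAt_hom_bundle]
  refine ⟨contMDiffAt_id, ?_⟩
  set T := (B.exists_triv k).choose with hTdef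
  have hT : k ∈ T.e.baseSet := (B.exists_triv k).choose_spec
  have hnhds := T.e.open_baseSet.mem_nhds hT
  have h : ContMDiffAt 𝓘(ℝ, EK) 𝓘(ℝ, ℝ →L[ℝ] ℝ) ∞
      (fun y => H (T.sec y) • ContinuousLinearMap.id ℝ ℝ) k :=
    ((hH.1.comp_contMDiffOn T.contMDiffOn_sec).contMDiffAt hnhds).smul contMDiffAt_const
  refine h.congr_of_eventuallyEq ?_
  filter_upwards [hnhds] with y hy
  have h1 : Trivialization.continuousLinearMapAt ℝ (trivializationAt ℝ (Bundle.Trivial K ℝ) k) y =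
      ContinuousLinearMap.id ℝ ℝ := Bundle.Trivial.continuousLinearMapAt_trivialization ..
  -- The frame vector of the preferred trivialization has coordinate 1.
  have h2 : T.tau (B.pt y) * B.fiberLinearEquiv y
      (Trivialization.symmL ℝ (trivializationAt ℝ B.LineFiber k) y 1) = 1 := by
    have hy' : y ∈ (trivializationAt ℝ B.LineFiber k).baseSet := hy
    rw [Trivialization.symmL_apply _ hy']
    exact congrArg Prod.snd ((trivializationAt ℝ B.LineFiber k).apply_mk_symm hy' 1)
  have h3 : H (B.pt y) = T.tau (B.pt y) * H (T.sec y) := by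
    have := T.eq_tau_mul hH.2 (x := B.pt y) (by rwa [(B.pt y).2])
    rwa [(B.pt y).2] at this
  simp only [ContinuousLinearMap.inCoordinates]
  ext
  refine (DFunLike.congr_fun h1 _).trans ?_
  change H (B.pt y) * B.fiberLinearEquiv y
    (Trivialization.symmL ℝ (trivializationAt ℝ B.LineFiber k) y 1) = H (T.sec y) * 1
  rw [h3, mul_right_comm, h2, one_mul, mul_one]

/-- The section of `L^*` determined by a homogeneous function. -/
def dualSection (H : P → ℝ) (hH : H ∈ homogeneousFunctions EP P G) : B.DualSection :=
  ⟨B.dualFun H, B.contMDiff_dualFun hH⟩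

theorem homFun_dualSection {H : P → ℝ} (hH : H ∈ homogeneousFunctions EP P G) :
    B.homFun (B.dualSection H hH) = H := by
  ext x
  obtain ⟨s, hs⟩ := B.exists_smul_eq (B.pt (B.proj x)).2
  have h1 : B.fiberLinearEquiv (B.proj x) (B.lineMk x 1) = scale s * 1 :=
    B.fiberLinearEquiv_fiberMk (x := ⟨x, rfl⟩) hs 1
  change H (B.pt (B.proj x)) • B.fiberLinearEquiv (B.proj x) (B.lineMk x 1) = H x
  rw [h1, mul_one, smul_eq_mul, mul_comm, ← hH.2, ← hs]

theorem bijOn_homFun : BijOn B.homFun univ (homogeneousFunctions EP P G) :=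
  ⟨fun h _ => B.homFun_mem h, B.homFun_injective.injOn,
    fun _ hH => ⟨B.dualSection _ hH, mem_univ _, B.homFun_dualSection hH⟩⟩

theorem homFun_add (h₁ h₂ : B.DualSection) : B.homFun (h₁ + h₂) = B.homFun h₁ + B.homFun h₂ := rfl

theorem homFun_smul (c : ℝ) (h : B.DualSection) : B.homFun (c • h) = c • B.homFun h := rfl

theorem homFun_neg (h : B.DualSection) : B.homFun (-h) = -B.homFun h := rfl

theorem homFun_zero : B.homFun 0 = 0 := rfl

theorem homFun_smulSection (f : C^∞⟮𝓘(ℝ, EK), K; ℝ⟯) (h : B.DualSection) :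
    B.homFun (smulSection f h) = (f ∘ B.proj) * B.homFun h := rfl

end ScalingBundle

/-! ### Symbols and Kirillov brackets on general vector bundles -/

section Sections

variable {E : Type*} [NormedAddCommGroup E] [NormedSpace ℝ E]
  {K : Type*} [TopologicalSpace K] [ChartedSpace E K] [IsManifold 𝓘(ℝ, E) ∞ K]
  {F : Type*} [NormedAddCommGroup F] [NormedSpace ℝ F]
  {V : K → Type*} [TopologicalSpace (TotalSpace F V)]
  [∀ k, AddCommGroup (V k)] [∀ k, Module ℝ (V k)] [∀ k, TopologicalSpace (V k)]
  [FiberBundle F V] [VectorBundle ℝ F V]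

/-- Every vector of a smooth vector bundle is the value of a global smooth section. -/
theorem exists_section_eq [FiniteDimensional ℝ E] [T2Space K] [ContMDiffVectorBundle ∞ F V 𝓘(ℝ, E)]
    {k : K} (v : V k) : ∃ h : Cₛ^∞⟮𝓘(ℝ, E); F, V⟯, h k = v := by
  obtain ⟨s, hs, hσ⟩ := FiberBundle.exists_contMDiffOn_extend (k := ∞) 𝓘(ℝ, E) F v
  obtain ⟨χ, -, hχ⟩ := (SmoothBumpFunction.nhds_basis_tsupport (I := 𝓘(ℝ, E)) k).mem_iff.1
    (interior_mem_nhds.2 hs)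
  -- The local extension is cut off by a bump function supported where it is smooth.
  refine ⟨⟨_, ContMDiffOn.smul_section_of_tsupport χ.contMDiff.contMDiffOn isOpen_interior hχ
    (hσ.mono interior_subset)⟩, ?_⟩
  change χ k • FiberBundle.extend F v k = v
  simp

theorem IsSymbol.neg {D : Cₛ^∞⟮𝓘(ℝ, E); F, V⟯ → Cₛ^∞⟮𝓘(ℝ, E); F, V⟯} {X : SmoothVectorField E K}
    (hD : IsSymbol D X) : IsSymbol (fun h => -D h) (-X) := by
  intro f h k
  have h1 : diff f k ((-X) k) = -diff f k (X k) := map_neg (diff f k) (X k)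
  change -D (smulSection f h) k = f k • -D h k + diff f k ((-X) k) • h k
  rw [hD f h k, h1, smul_neg, neg_smul, neg_add]

/-- The commutator of two derivations has as symbol the commutator of the symbols. -/
theorem IsSymbol.commutator [CompleteSpace E]
    {D₁ D₂ : Cₛ^∞⟮𝓘(ℝ, E); F, V⟯ →ₗ[ℝ] Cₛ^∞⟮𝓘(ℝ, E); F, V⟯} {X₁ X₂ : SmoothVectorField E K}
    (h₁ : IsSymbol D₁ X₁) (h₂ : IsSymbol D₂ X₂) (f : C^∞⟮𝓘(ℝ, E), K; ℝ⟯)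
    (h : Cₛ^∞⟮𝓘(ℝ, E); F, V⟯) (k : K) :
    D₁ (D₂ (smulSection f h)) k - D₂ (D₁ (smulSection f h)) k =
      f k • (D₁ (D₂ h) k - D₂ (D₁ h) k) +
        diff f k (VectorField.mlieBracket 𝓘(ℝ, E) X₁ X₂ k) • h k := by
  -- `X Y` is the derivative `Y(f)` as a smooth function, so that the Leibniz rule can be applied a
  -- second time.
  let X : SmoothVectorField E K → C^∞⟮𝓘(ℝ, E), K; ℝ⟯ := fun Y =>
    ⟨fun y => diff f y (Y y), contMDiff_diff_apply f.contMDiff Y.contMDiff⟩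
  have hexp : ∀ {D : Cₛ^∞⟮𝓘(ℝ, E); F, V⟯ →ₗ[ℝ] Cₛ^∞⟮𝓘(ℝ, E); F, V⟯} {Y : SmoothVectorField E K},
      IsSymbol D Y → D (smulSection f h) = smulSection f (D h) + smulSection (X Y) h :=
    fun hD => ContMDiffSection.ext fun y => hD f h y
  have hadd : ∀ (D : Cₛ^∞⟮𝓘(ℝ, E); F, V⟯ →ₗ[ℝ] Cₛ^∞⟮𝓘(ℝ, E); F, V⟯)
      (a b : Cₛ^∞⟮𝓘(ℝ, E); F, V⟯), D (a + b) k = D a k + D b k := by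
    intro D a b
    rw [map_add]
    rfl
  rw [hexp h₁, hexp h₂, hadd, hadd, h₁, h₁, h₂, h₂, diff_mlieBracket f.contMDiff X₁ X₂ k]
  -- The mixed terms `X₁(f) D₂ h` and `X₂(f) D₁ h` occur in both composites and cancel.
  change f k • D₁ (D₂ h) k + diff f k (X₁ k) • D₂ h k +
      (diff f k (X₂ k) • D₁ h k + diff (fun y => diff f y (X₂ y)) k (X₁ k) • h k) -
    (f k • D₂ (D₁ h) k + diff f k (X₂ k) • D₁ h k +
      (diff f k (X₁ k) • D₂ h k + diff (fun y => diff f y (X₁ y)) k (X₂ k) • h k)) = _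
  rw [smul_sub, sub_smul]
  abel

theorem KirillovBracket.isSymbol_symbol (κ : KirillovBracket E F V) (h : Cₛ^∞⟮𝓘(ℝ, E); F, V⟯) :
    IsSymbol (fun h₁ => κ.bracket h₁ h) (κ.symbol h) :=
  (κ.exists_symbol h).choose_spec

theorem KirillovBracket.bracket_swap (κ : KirillovBracket E F V) (h₁ h₂ : Cₛ^∞⟮𝓘(ℝ, E); F, V⟯) :
    κ.bracket h₁ h₂ = -κ.bracket h₂ h₁ := by
  have h := κ.bracket_self (h₁ + h₂)
  simp only [map_add, LinearMap.add_apply, κ.bracket_self, zero_add, add_zero] at h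
  exact eq_neg_of_add_eq_zero_right h

theorem KirillovBracket.ext {κ₁ κ₂ : KirillovBracket E F V}
    (h : ∀ h₁ h₂, κ₁.bracket h₁ h₂ = κ₂.bracket h₁ h₂) : κ₁ = κ₂ := by
  have : κ₁.bracket = κ₂.bracket := LinearMap.ext₂ h
  cases κ₁
  cases κ₂
  cases this
  rfl

/-- Both vector fields act as symbols of the same derivation, the commutator of `[·, h₁]` and `[·,
h₂]`. The factor `h k` stays because a symbol is visible only through its action on sections; for
`L^*` it is removed by `eq_of_forall_diff_smul_eq`. -/
theorem KirillovBracket.diff_mlieBracket_symbol_smul [CompleteSpace E]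
    (κ : KirillovBracket E F V) (h₁ h₂ h : Cₛ^∞⟮𝓘(ℝ, E); F, V⟯) (f : C^∞⟮𝓘(ℝ, E), K; ℝ⟯) (k : K) :
    diff f k (VectorField.mlieBracket 𝓘(ℝ, E) (κ.symbol h₁) (κ.symbol h₂) k) • h k =
      diff f k (-κ.symbol (κ.bracket h₁ h₂) k) • h k := by
  -- The Jacobi identity as a commutator formula. The minus sign arises because the operators
  -- bracket from the right.
  have hcomm : ∀ g, κ.bracket (κ.bracket g h₂) h₁ - κ.bracket (κ.bracket g h₁) h₂ =
      -κ.bracket g (κ.bracket h₁ h₂) := by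
    intro g
    have hj := κ.jacobi g h₁ h₂
    have e1 : κ.bracket (κ.bracket h₁ h₂) g = -κ.bracket g (κ.bracket h₁ h₂) := κ.bracket_swap _ _
    have e2 : κ.bracket (κ.bracket h₂ g) h₁ = -κ.bracket (κ.bracket g h₂) h₁ := by
      rw [κ.bracket_swap h₂ g, map_neg, LinearMap.neg_apply]
    rw [e1, e2] at hj
    rw [eq_comm, ← sub_eq_zero, ← hj]
    abel
  have hc := IsSymbol.commutator (D₁ := κ.bracket.flip h₁) (D₂ := κ.bracket.flip h₂)
    (κ.isSymbol_symbol h₁) (κ.isSymbol_symbol h₂) f h k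
  have hcomm' : ∀ g, κ.bracket (κ.bracket g h₂) h₁ k - κ.bracket (κ.bracket g h₁) h₂ k =
      -κ.bracket g (κ.bracket h₁ h₂) k := fun g => congrArg (fun a => a k) (hcomm g)
  simp only [LinearMap.flip_apply, hcomm'] at hc
  rw [κ.isSymbol_symbol (κ.bracket h₁ h₂) f h k, neg_add, smul_neg, add_right_inj] at hc
  rw [← hc, map_neg, neg_smul]

end Sections

/-! ### Reduction of the Poisson structure to the base -/

namespace ScalingBundle

variable {G : OpenSubgroup ℝˣ}
  {EP : Type*} [NormedAddCommGroup EP] [NormedSpace ℝ EP]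
  {P : Type*} [TopologicalSpace P] [ChartedSpace EP P] [MulAction G P]
  {EK : Type*} [NormedAddCommGroup EK] [NormedSpace ℝ EK]
  {K : Type*} [TopologicalSpace K] [ChartedSpace EK K]
  (B : ScalingBundle G EP P EK K)

section Bracket

variable [IsManifold 𝓘(ℝ, EP) ∞ P] {Λ : Bivector EP P}

/-- The chain rule for `f ∘ proj`. The free `k` allows `x` and `pt (proj x)` to be compared in one
tangent space, although their projections agree only propositionally. -/
theorem diff_mfderiv_hamiltonian (f : C^∞⟮𝓘(ℝ, EK), K; ℝ⟯) (H : P → ℝ) (x : P) {k : K}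
    (hk : B.proj x = k) :
    diff (E := EK) f k (mfderiv 𝓘(ℝ, EP) 𝓘(ℝ, EK) B.proj x (Λ.hamiltonian H x) : EK) =
      Λ.poissonBracket (f ∘ B.proj) H x := by
  subst hk
  rw [Λ.poissonBracket_eq_diff_hamiltonian, diff_comp (f.contMDiff.mdifferentiable (by simp) _)
    (B.contMDiff_proj.mdifferentiable (by simp) x)]
  rfl

/-- The bracket of sections with `{H_{h₁}, H_{h₂}} = -H_{[h₁, h₂]}`. -/
def bracketSection (hG : Λ.IsHomogeneous G) (h₁ h₂ : B.DualSection) : B.DualSection :=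
  -B.dualSection (Λ.poissonBracket (B.homFun h₁) (B.homFun h₂))
    (hG.poissonBracket_mem B.contMDiff_const_smul (B.homFun_mem h₁) (B.homFun_mem h₂))

theorem homFun_bracketSection (hG : Λ.IsHomogeneous G) (h₁ h₂ : B.DualSection) :
    B.homFun (B.bracketSection hG h₁ h₂) = -Λ.poissonBracket (B.homFun h₁) (B.homFun h₂) := by
  rw [bracketSection, homFun_neg, homFun_dualSection]

end Bracket

variable [IsManifold 𝓘(ℝ, EK) ∞ K]

/-- Fibres of `L` are spanned by `[x, 1]`, so an identity in `L^*` may be tested on that vector. -/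
theorem isSymbol_iff_homFun {D : B.DualSection → B.DualSection} {X : SmoothVectorField EK K} :
    IsSymbol D X ↔ ∀ (f : C^∞⟮𝓘(ℝ, EK), K; ℝ⟯) (h : B.DualSection) (x : P),
      B.homFun (D (smulSection f h)) x = f (B.proj x) * B.homFun (D h) x +
        diff f (B.proj x) (X (B.proj x)) * B.homFun h x := by
  refine ⟨fun H f h x => DFunLike.congr_fun (H f h (B.proj x)) (B.lineMk x 1), fun H f h k => ?_⟩
  obtain ⟨x, rfl⟩ := B.proj_surjective k
  exact B.dual_ext (H f h x)

variable [FiniteDimensional ℝ EK] [T2Space K]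

/-- The coordinate functional of the fibre is injective, hence nonzero on `[x, 1]`, and it extends
to a global section. -/
theorem exists_homFun_ne_zero (x : P) : ∃ h : B.DualSection, B.homFun h x ≠ 0 := by
  obtain ⟨h, hh⟩ := exists_section_eq (E := EK) (F := ℝ →L[ℝ] ℝ) (V := B.DualFiber)
    (B.fiberCLM (B.proj x))
  refine ⟨h, fun h0 => ?_⟩
  rw [homFun, hh] at h0
  have h1 : B.fiberLinearEquiv (B.proj x) (B.lineMk x 1) = 0 := h0
  rw [LinearEquiv.map_eq_zero_iff] at h1
  have h2 : B.lineMk x 1 = B.lineMk x 0 := by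
    rw [h1, lineMk, ← zero_mul (1 : ℝ), ← B.smul_fiberMk, zero_smul]
  exact one_ne_zero ((B.fiberMk_bijective ⟨x, rfl⟩).1 h2)

theorem eq_of_forall_diff_smul_eq {k : K} {v w : TangentSpace 𝓘(ℝ, EK) k}
    (H : ∀ (f : C^∞⟮𝓘(ℝ, EK), K; ℝ⟯) (h : B.DualSection),
      diff f k v • h k = diff f k w • h k) : v = w := by
  refine eq_of_forall_diff_eq fun f => ?_
  obtain ⟨x, rfl⟩ := B.proj_surjective k
  obtain ⟨h, hh⟩ := B.exists_homFun_ne_zero x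
  exact mul_right_cancel₀ hh (DFunLike.congr_fun (H f h) (B.lineMk x 1))

theorem isSymbol_unique {D : B.DualSection → B.DualSection} {X Y : SmoothVectorField EK K}
    (hX : IsSymbol D X) (hY : IsSymbol D Y) : X = Y := by
  ext1 k
  refine B.eq_of_forall_diff_smul_eq fun f h => ?_
  have := (hX f h k).symm.trans (hY f h k)
  exact add_left_cancel this

/-! ### Projection of Hamiltonian vector fields -/

variable [IsManifold 𝓘(ℝ, EP) ∞ P] {Λ : Bivector EP P}

/-- The projection to the orbit manifold of the Hamiltonian vector field of a function. -/
def projFun (Λ : Bivector EP P) (H : P → ℝ) (k : K) : TangentSpace 𝓘(ℝ, EK) k :=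
  (mfderiv 𝓘(ℝ, EP) 𝓘(ℝ, EK) B.proj (B.pt k) (Λ.hamiltonian H (B.pt k)) : EK)

/-- Tested on `f`, both sides are values of the invariant function `{f ∘ proj, H}` at two points of
one orbit. -/
theorem mfderiv_proj_hamiltonian (hG : Λ.IsHomogeneous G) {H : P → ℝ}
    (hH : H ∈ homogeneousFunctions EP P G) (x : P) :
    mfderiv 𝓘(ℝ, EP) 𝓘(ℝ, EK) B.proj x (Λ.hamiltonian H x) = B.projFun Λ H (B.proj x) := by
  refine eq_of_forall_diff_eq fun f => ?_
  refine (B.diff_mfderiv_hamiltonian f H x rfl).trans (Eq.trans ?_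
    (B.diff_mfderiv_hamiltonian f H (B.pt (B.proj x)) (B.pt (B.proj x)).2).symm)
  obtain ⟨s, hs⟩ := B.exists_smul_eq (B.pt (B.proj x)).2
  conv_lhs => rw [hs]
  exact hG.poissonBracket_smul_of_invariant B.contMDiff_const_smul
    (f.contMDiff.comp B.contMDiff_proj) (fun s y => congrArg f (B.proj_smul s y)) hH s _

/-- By projectability `pt` may be replaced near `k` by a smooth local section; the field then
becomes a composite of smooth maps. -/
theorem contMDiff_projFun (hG : Λ.IsHomogeneous G) {H : P → ℝ}
    (hH : H ∈ homogeneousFunctions EP P G) :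
    ContMDiff 𝓘(ℝ, EK) (𝓘(ℝ, EK).prod 𝓘(ℝ, EK)) ∞
      (fun k => TotalSpace.mk' EK (E := (TangentSpace 𝓘(ℝ, EK) : K → Type _)) k
        (B.projFun Λ H k)) := by
  intro k
  obtain ⟨T, hT⟩ := B.exists_triv k
  have hnhds := T.e.open_baseSet.mem_nhds hT
  have h := ((B.contMDiff_proj.contMDiff_tangentMap (m := ∞) (by simp)).comp
    (Λ.contMDiff_hamiltonian hH.1)).comp_contMDiffOn T.contMDiffOn_sec
  refine (h.contMDiffAt hnhds).congr_of_eventuallyEq ?_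
  filter_upwards [hnhds] with y hy
  have aux : ∀ (x : P) (y : K), B.proj x = y →
      TotalSpace.mk' EK (E := (TangentSpace 𝓘(ℝ, EK) : K → Type _)) y (B.projFun Λ H y) =
      tangentMap 𝓘(ℝ, EP) 𝓘(ℝ, EK) B.proj ⟨x, Λ.hamiltonian H x⟩ := by
    rintro x _ rfl
    exact congrArg (TotalSpace.mk' EK (E := (TangentSpace 𝓘(ℝ, EK) : K → Type _)) (B.proj x))
      (B.mfderiv_proj_hamiltonian hG hH x).symm
  exact aux _ _ (T.proj_sec hy)

/-- The projection to the orbit manifold of the Hamiltonian vector field of `H_h`. -/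
def projField (hG : Λ.IsHomogeneous G) (h : B.DualSection) : SmoothVectorField EK K :=
  ⟨B.projFun Λ (B.homFun h), B.contMDiff_projFun hG (B.homFun_mem h)⟩

/-- The Leibniz rule for `{(f ∘ proj) H_{h₁}, H_h}`, in which `{f ∘ proj, H_h}` is the projected
field applied to `f`. Since `D` is arbitrary, this serves both to construct the bracket and to
identify the symbol of any bracket satisfying (b). -/
theorem isSymbol_neg_projField (hG : Λ.IsHomogeneous G) {h : B.DualSection}
    {D : B.DualSection → B.DualSection}
    (hD : ∀ h₁, Λ.poissonBracket (B.homFun h₁) (B.homFun h) = -B.homFun (D h₁)) :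
    IsSymbol D (-B.projField hG h) := by
  rw [isSymbol_iff_homFun]
  intro f h₁ x
  have h1 : ∀ h₁, B.homFun (D h₁) x = -Λ.poissonBracket (B.homFun h₁) (B.homFun h) x := by
    intro h₁
    rw [hD, Pi.neg_apply, neg_neg]
  have h2 : diff f (B.proj x) ((-B.projField hG h) (B.proj x)) =
      -Λ.poissonBracket (f ∘ B.proj) (B.homFun h) x := by
    refine (map_neg (diff f (B.proj x)) (B.projField hG h (B.proj x))).trans ?_
    rw [← B.diff_mfderiv_hamiltonian f (B.homFun h) x rfl,
      B.mfderiv_proj_hamiltonian hG (B.homFun_mem h) x]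
    rfl
  rw [h1, h1, h2, B.homFun_smulSection, Λ.poissonBracket_mul_left _
    (f.contMDiff.comp B.contMDiff_proj) (B.contMDiff_homFun h₁)]
  simp only [Function.comp_apply]
  ring

/-! ### The reduced bracket -/

/-- The Kirillov bracket on the sections of `L^*` induced by a homogeneous Poisson structure. -/
def kirillovBracket (hΛ : Λ.IsPoisson) (hG : Λ.IsHomogeneous G) :
    KirillovBracket EK (ℝ →L[ℝ] ℝ) B.DualFiber where
  bracket := LinearMap.mk₂ ℝ (B.bracketSection hG)
    (fun a b c => B.homFun_injective (by
      simp only [homFun_add, homFun_bracketSection, Λ.poissonBracket_add_left _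
        (B.contMDiff_homFun a) (B.contMDiff_homFun b), neg_add]))
    (fun c a b => B.homFun_injective (by
      simp only [homFun_smul, homFun_bracketSection, Λ.poissonBracket_smul_left _ _
        (B.contMDiff_homFun a), smul_neg]))
    (fun a b c => B.homFun_injective (by
      simp only [homFun_add, homFun_bracketSection, Λ.poissonBracket_add_right _
        (B.contMDiff_homFun b) (B.contMDiff_homFun c), neg_add]))
    (fun c a b => B.homFun_injective (by
      simp only [homFun_smul, homFun_bracketSection, Λ.poissonBracket_smul_right _ _
        (B.contMDiff_homFun b), smul_neg]))
  bracket_self h := B.homFun_injective (by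
    rw [LinearMap.mk₂_apply, homFun_bracketSection, Λ.poissonBracket_self, neg_zero, homFun_zero])
  jacobi h₁ h₂ h₃ := B.homFun_injective (by
    -- The two minus signs of a nested bracket cancel, leaving the Jacobi identity of `Π`.
    simp only [LinearMap.mk₂_apply, homFun_add, homFun_bracketSection,
      Λ.poissonBracket_neg_left, neg_neg, homFun_zero]
    exact funext (hΛ ⟨_, B.contMDiff_homFun h₁⟩ ⟨_, B.contMDiff_homFun h₂⟩
      ⟨_, B.contMDiff_homFun h₃⟩))
  exists_symbol h := ⟨-B.projField hG h, B.isSymbol_neg_projField hG fun h₁ => by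
    rw [LinearMap.mk₂_apply, homFun_bracketSection, neg_neg]⟩

theorem poissonBracket_eq_neg_homFun_kirillovBracket (hΛ : Λ.IsPoisson) (hG : Λ.IsHomogeneous G)
    (h₁ h₂ : B.DualSection) : Λ.poissonBracket (B.homFun h₁) (B.homFun h₂) =
      -B.homFun ((B.kirillovBracket hΛ hG).bracket h₁ h₂) :=
  (neg_eq_iff_eq_neg.2 (B.homFun_bracketSection hG h₁ h₂)).symm

end ScalingBundle

end ScalingReduction

end

theorem mainTheorem1
    {EP : Type*} [NormedAddCommGroup EP] [NormedSpace ℝ EP] [FiniteDimensional ℝ EP]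
    {P : Type*} [TopologicalSpace P] [T2Space P] [SecondCountableTopology P]
    [ChartedSpace EP P] [IsManifold 𝓘(ℝ, EP) ∞ P]
    {EK : Type*} [NormedAddCommGroup EK] [NormedSpace ℝ EK] [FiniteDimensional ℝ EK]
    {K : Type*} [TopologicalSpace K] [T2Space K] [SecondCountableTopology K]
    [ChartedSpace EK K] [IsManifold 𝓘(ℝ, EK) ∞ K]
    (G : OpenSubgroup ℝˣ) [MulAction G P] (B : ScalingBundle G EP P EK K)
    (Λ : Bivector EP P) (hΛ : Λ.IsPoisson) (hG : Λ.IsHomogeneous G) :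
    -- (a) homogeneous functions are the sections of `L^*`
    Set.BijOn B.homFun Set.univ (homogeneousFunctions EP P G) ∧
    (∀ (h : B.DualSection) (x : P) (t : ℝ), h (B.proj x) (B.lineMk x t) = t * B.homFun h x) ∧
    -- (b) the Kirillov bracket
    (∃! κ : KirillovBracket EK (ℝ →L[ℝ] ℝ) B.DualFiber, ∀ h₁ h₂ : B.DualSection,
      Λ.poissonBracket (B.homFun h₁) (B.homFun h₂) = -B.homFun (κ.bracket h₁ h₂)) ∧
    ∀ κ : KirillovBracket EK (ℝ →L[ℝ] ℝ) B.DualFiber,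
      (∀ h₁ h₂ : B.DualSection,
        Λ.poissonBracket (B.homFun h₁) (B.homFun h₂) = -B.homFun (κ.bracket h₁ h₂)) →
      -- `X_h` is the unique symbol of `[·, h]`
      (∀ (h : B.DualSection) (X : SmoothVectorField EK K),
        IsSymbol (fun h₁ => κ.bracket h₁ h) X ↔ X = κ.symbol h) ∧
      -- (c): `X_H` projects to `-X_h`, which is the symbol of `[h, ·]`
      (∀ h : B.DualSection, IsSymbol (fun h₁ => κ.bracket h h₁) (-κ.symbol h)) ∧
      (∀ (h : B.DualSection) (x : P),
        mfderiv 𝓘(ℝ, EP) 𝓘(ℝ, EK) B.proj x (Λ.hamiltonian (B.homFun h) x) =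
          -κ.symbol h (B.proj x)) ∧
      -- (d) brackets of symbols
      (∀ (h₁ h₂ : B.DualSection) (k : K),
        VectorField.mlieBracket 𝓘(ℝ, EK) (κ.symbol h₁) (κ.symbol h₂) k =
          -κ.symbol (κ.bracket h₁ h₂) k) := by
  refine ⟨B.bijOn_homFun, B.apply_lineMk, ⟨B.kirillovBracket hΛ hG,
    B.poissonBracket_eq_neg_homFun_kirillovBracket hΛ hG, fun κ hκ =>
      KirillovBracket.ext fun h₁ h₂ => B.homFun_injective (neg_injective ?_)⟩, fun κ hκ => ?_⟩
  · rw [← hκ, ← B.poissonBracket_eq_neg_homFun_kirillovBracket hΛ hG]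
  -- `κ.symbol` is a mere choice among symbols; uniqueness identifies it with minus the projected
  -- Hamiltonian field.
  have hsymb : ∀ h, κ.symbol h = -B.projField hG h := fun h =>
    B.isSymbol_unique (κ.isSymbol_symbol h) (B.isSymbol_neg_projField hG fun h₁ => hκ h₁ h)
  refine ⟨fun h X => ⟨fun hX => B.isSymbol_unique hX (κ.isSymbol_symbol h), ?_⟩, fun h => ?_,
    fun h x => ?_, fun h₁ h₂ k => B.eq_of_forall_diff_smul_eq fun f h =>
      κ.diff_mlieBracket_symbol_smul h₁ h₂ h f k⟩
  · rintro rfl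
    exact κ.isSymbol_symbol h
  · simp only [κ.bracket_swap h]
    exact (κ.isSymbol_symbol h).neg
  · rw [hsymb]
    exact (B.mfderiv_proj_hamiltonian hG (B.homFun_mem h) x).trans (neg_neg _).symm
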